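/- Let $X$ be a connected, locally path connected and first countable topological space. For an open cover $\mathcal{U}$ of $X$ and $y\in X$, let $\pi(\mathcal{U},y)\le\pi_1(X,y)$ be the subgroup consisting of all classes of finite products $\prod_{j=1}^{n}\alpha_j*\beta_j*\alpha_j^{-1}$, where each $\alpha_j$ is a path in $X$ starting at $y$ and each $\beta_j$ is a loop based at $\alpha_j(1)$ and lying inside some member of $\mathcal{U}$. Let the Spanier group $\pi_1^{sp}(X,y)=\bigcap_{\mathcal{U}}\pi(\mathcal{U},y)$ be the intersection over all open covers $\mathcal{U}$ of $X$. A point $y\in X$ is called regular if $X$ is semi-locally simply connected at $y$, that is, if $y$ has an open neighborhood $U$ such that every loop in $U$ based at $y$ is null-homotopic in $X$ relative to endpoints. A non-regular point $y$ is called wild if for every open neighborhood $U$ of $y$ there is a loop $\alpha$ in $U$ based at $y$ with $[\alpha]\notin\pi_1^{sp}(X,y)$. If $X$ has a wild point, then $\pi_1(X,x)$ is uncountable for every $x\in X$. -/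

import Mathlib

/-- The class `[γ] ∈ π₁(X, x)` of a loop `γ` at `x`. -/
def loopClass {X : Type*} [TopologicalSpace X] {x : X} (γ : Path x x) : FundamentalGroup X x :=
  FundamentalGroup.fromPath (Path.Homotopic.Quotient.mk γ)

/-- `𝒰` is a cover of `X` by open sets. -/
def IsOpenCoverFamily {X : Type*} [TopologicalSpace X] (𝒰 : Set (Set X)) : Prop :=
  (∀ U ∈ 𝒰, IsOpen U) ∧ ⋃₀ 𝒰 = Set.univ

/-- The classes of the loops `α * β * α⁻¹`, where `α` is a path in `X` starting at `x` and `β` is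
a loop at the end point of `α` that lies inside a member of `𝒰`. -/
def spanierGenerators {X : Type*} [TopologicalSpace X] (𝒰 : Set (Set X)) (x : X) :
    Set (FundamentalGroup X x) :=
  {g | ∃ (y : X) (α : Path x y) (β : Path y y), (∃ U ∈ 𝒰, Set.range β ⊆ U) ∧
    g = loopClass ((α.trans β).trans α.symm)}

/-- The Spanier group `π(𝒰, x)` with respect to the cover `𝒰`. The set of generators is closed under
inverses (reverse `β`), so the subgroup it generates is the set of its finite products. -/
noncomputable def spanierGroupOfCover {X : Type*} [TopologicalSpace X] (𝒰 : Set (Set X)) (x : X) :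
    Subgroup (FundamentalGroup X x) :=
  Subgroup.closure (spanierGenerators 𝒰 x)

/-- The Spanier group `π₁ˢᵖ(X, x)`, the intersection of the groups `π(𝒰, x)` over all open covers
`𝒰` of `X`. -/
noncomputable def spanierGroup (X : Type*) [TopologicalSpace X] (x : X) : Subgroup (FundamentalGroup X x) :=
  ⨅ (𝒰 : Set (Set X)) (_ : IsOpenCoverFamily 𝒰), spanierGroupOfCover 𝒰 x

/-- `X` is semi-locally simply connected at `x`: some open neighborhood `U` of `x` is such that every
loop at `x` in `U` is null-homotopic in `X`. -/
def IsRegularPoint {X : Type*} [TopologicalSpace X] (x : X) : Prop :=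
  ∃ U : Set X, IsOpen U ∧ x ∈ U ∧ ∀ γ : Path x x, Set.range γ ⊆ U → loopClass γ = 1

/-- A non-regular point `x` is wild if every open neighborhood of `x` contains a loop at `x` whose
class is not in the Spanier group `π₁ˢᵖ(X, x)`. -/
def IsWildPoint {X : Type*} [TopologicalSpace X] (x : X) : Prop :=
  ¬ IsRegularPoint x ∧
    ∀ U : Set X, IsOpen U → x ∈ U →
      ∃ γ : Path x x, Set.range γ ⊆ U ∧ loopClass γ ∉ spanierGroup X x

/-! Around a wild point `y`, choose a shrinking neighborhood basis `W n`, loops `α n` in `W n`, and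
subgroups `H n` that miss the class of `α n` but contain that of every loop in `W (n + 1)`. A binary
sequence `s` selects a subsequence of the `α n`, and its infinite concatenation is a loop because
the `α n` shrink to `y`. Modulo `H n`, the tail from `n` on depends only on whether `α n` is
selected, so its class determines `s n`. Cancelling that factor leaves the next tail, so the class
determines all of `s`, and `2^ℕ` embeds in the fundamental group. -/

open Set Filter Topology

namespace Path

variable {X : Type*} [TopologicalSpace X] {y : X}

/-- The concatenation `β 0 * (β 1 * (⋯ * (β (n - 1) * refl)))` of the first `n` loops. -/
noncomputable def partialConcat : ℕ → (ℕ → Path y y) → Path y y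
  | 0, _ => Path.refl y
  | n + 1, β => (β 0).trans (partialConcat n fun k => β (k + 1))

/-- Right nesting puts loop `k` on `[1 - 2⁻ᵏ, 1 - 2⁻ᵏ⁻¹]`, so later loops do not affect earlier
times. -/
theorem partialConcat_extend_eq {n m : ℕ} (hnm : n ≤ m) (β : ℕ → Path y y) {t : ℝ}
    (ht : t ≤ 1 - (1 / 2) ^ n) : (partialConcat m β).extend t = (partialConcat n β).extend t := by
  induction n generalizing m β t with
  | zero =>
    have ht0 : t ≤ 0 := by simpa using ht
    rw [Path.extend_of_le_zero _ ht0, Path.extend_of_le_zero _ ht0]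
  | succ n ih =>
    obtain ⟨m, rfl⟩ : ∃ k, m = k + 1 := ⟨m - 1, by omega⟩
    simp only [partialConcat]
    rcases le_total t (1 / 2) with h | h
    · rw [Path.extend_trans_of_le_half _ _ h, Path.extend_trans_of_le_half _ _ h]
    · rw [Path.extend_trans_of_half_le _ _ h, Path.extend_trans_of_half_le _ _ h]
      refine ih (by omega) _ ?_
      rw [pow_succ] at ht
      linarith

/-- The bound is uniform in `m`; this yields continuity of the infinite concatenation at time 1. -/
theorem partialConcat_extend_mem {U : Set X} (hy : y ∈ U) {n : ℕ} (m : ℕ) {β : ℕ → Path y y}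
    (hβ : ∀ k, n ≤ k → range (β k) ⊆ U) {t : ℝ} (ht : 1 - (1 / 2) ^ n ≤ t) :
    (partialConcat m β).extend t ∈ U := by
  induction m generalizing n β t with
  | zero => simpa [partialConcat] using hy
  | succ m ih =>
    simp only [partialConcat]
    rcases le_or_gt t (1 / 2) with h | h
    · rw [Path.extend_trans_of_le_half _ _ h]
      cases n with
      | zero => exact hβ 0 le_rfl (Path.extend_range (β 0) ▸ mem_range_self _)
      | succ n =>
        have : (1 / 2 : ℝ) ^ n ≤ 1 := pow_le_one₀ (by norm_num) (by norm_num)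
        rw [pow_succ] at ht
        rw [Path.extend_of_one_le _ (by linarith)]
        exact hy
    · rw [Path.extend_trans_of_half_le _ _ h.le]
      cases n with
      | zero => exact ih (n := 0) (fun k _ => hβ _ (Nat.zero_le _)) (by norm_num; linarith)
      | succ n =>
        rw [pow_succ] at ht
        exact ih (n := n) (fun k hk => hβ _ (by omega)) (by linarith)

theorem exists_le_one_sub_half_pow {t : ℝ} (ht : t < 1) : ∃ n : ℕ, t < 1 - (1 / 2) ^ n := by
  obtain ⟨n, hn⟩ := exists_pow_lt_of_lt_one (sub_pos.2 ht) (by norm_num : (1 / 2 : ℝ) < 1)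
  exact ⟨n, by linarith⟩

open Classical in
/-- The infinite concatenation `β 0 * (β 1 * (β 2 * ⋯))` as a function on the real line. -/
noncomputable def infiniteConcatFun (β : ℕ → Path y y) (t : ℝ) : X :=
  if h : t < 1 then (partialConcat (Nat.find (exists_le_one_sub_half_pow h)) β).extend t else y

theorem infiniteConcatFun_eq (β : ℕ → Path y y) {n : ℕ} {t : ℝ} (ht : t < 1 - (1 / 2) ^ n) :
    infiniteConcatFun β t = (partialConcat n β).extend t := by
  classical
  have h1 : t < 1 := ht.trans (by simp)
  have h := exists_le_one_sub_half_pow h1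
  rw [infiniteConcatFun, dif_pos h1]
  exact (partialConcat_extend_eq (Nat.find_min' h ht) β (Nat.find_spec h).le).symm

theorem infiniteConcatFun_of_one_le (β : ℕ → Path y y) {t : ℝ} (ht : 1 ≤ t) :
    infiniteConcatFun β t = y := dif_neg ht.not_gt

theorem infiniteConcatFun_mem {U : Set X} (hy : y ∈ U) {n : ℕ} {β : ℕ → Path y y}
    (hβ : ∀ k, n ≤ k → range (β k) ⊆ U) {t : ℝ} (ht : 1 - (1 / 2) ^ n ≤ t) :
    infiniteConcatFun β t ∈ U := by
  rcases lt_or_ge t 1 with h | h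
  · obtain ⟨m, hm⟩ := exists_le_one_sub_half_pow h
    rw [infiniteConcatFun_eq β hm]
    exact partialConcat_extend_mem hy m hβ ht
  · rwa [infiniteConcatFun_of_one_le β h]

/-- A sequence of loops at `y` shrinks to `y` if every neighborhood of `y` contains all but finitely
many of them. -/
def ShrinksToBase (β : ℕ → Path y y) : Prop :=
  ∀ U ∈ 𝓝 y, ∃ n, ∀ k, n ≤ k → range (β k) ⊆ U

theorem ShrinksToBase.tail {β : ℕ → Path y y} (hβ : ShrinksToBase β) :
    ShrinksToBase fun k => β (k + 1) := fun U hU =>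
  (hβ U hU).imp fun _ hn k hk => hn (k + 1) (by omega)

theorem ShrinksToBase.continuous_infiniteConcatFun {β : ℕ → Path y y} (hβ : ShrinksToBase β) :
    Continuous (infiniteConcatFun β) := by
  rw [continuous_iff_continuousAt]
  intro t
  rcases lt_or_ge t 1 with h | h
  · obtain ⟨n, hn⟩ := exists_le_one_sub_half_pow h
    refine (partialConcat n β).continuous_extend.continuousAt.congr ?_
    filter_upwards [Iio_mem_nhds hn] with s hs using (infiniteConcatFun_eq β hs).symm
  · rw [ContinuousAt, infiniteConcatFun_of_one_le β h]
    intro U hU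
    obtain ⟨n, hn⟩ := hβ U hU
    have hlt : 1 - (1 / 2 : ℝ) ^ n < t := lt_of_lt_of_le (by simp) h
    refine mem_map.2 ?_
    filter_upwards [Ioi_mem_nhds hlt] with s hs
    exact infiniteConcatFun_mem (mem_of_mem_nhds hU) hn (le_of_lt hs)

/-- The infinite concatenation `β 0 * (β 1 * (β 2 * ⋯))` of a sequence of loops shrinking to the
base point. -/
noncomputable def infiniteConcat (β : ℕ → Path y y) (hβ : ShrinksToBase β) : Path y y where
  toFun t := infiniteConcatFun β t
  continuous_toFun := hβ.continuous_infiniteConcatFun.comp continuous_subtype_val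
  source' := by
    rw [infiniteConcatFun_eq β (n := 1) (by norm_num)]
    simp
  target' := infiniteConcatFun_of_one_le β (by simp)

theorem range_infiniteConcat_subset {U : Set X} (hy : y ∈ U) {β : ℕ → Path y y}
    (hβ : ShrinksToBase β) (hU : ∀ k, range (β k) ⊆ U) : range (infiniteConcat β hβ) ⊆ U := by
  rintro _ ⟨t, rfl⟩
  exact infiniteConcatFun_mem (n := 0) hy (fun k _ => hU k) (by simpa using t.2.1)

/-- Right nesting makes this an equality of paths, with no reparametrization. -/
theorem infiniteConcat_eq_trans {β : ℕ → Path y y} (hβ : ShrinksToBase β) :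
    infiniteConcat β hβ = (β 0).trans (infiniteConcat _ hβ.tail) := by
  ext t
  rcases lt_or_ge (t : ℝ) 1 with h | h
  · obtain ⟨n, hn⟩ := exists_le_one_sub_half_pow h
    have hn' : (t : ℝ) < 1 - (1 / 2) ^ (n + 1) := by
      have : (0 : ℝ) < (1 / 2) ^ n := by positivity
      rw [pow_succ]
      linarith
    change infiniteConcatFun β t = _
    rw [infiniteConcatFun_eq β hn', partialConcat, ← Path.extend_apply ((β 0).trans _) t.2]
    rcases le_or_gt (t : ℝ) (1 / 2) with h2 | h2
    · rw [Path.extend_trans_of_le_half _ _ h2, Path.extend_trans_of_le_half _ _ h2]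
    · rw [Path.extend_trans_of_half_le _ _ h2.le, Path.extend_trans_of_half_le _ _ h2.le,
        Path.extend_apply (infiniteConcat _ hβ.tail) ⟨by linarith, by linarith⟩]
      refine (infiniteConcatFun_eq _ ?_).symm
      rw [pow_succ] at hn'
      linarith
  · obtain rfl : t = 1 := Subtype.ext (le_antisymm t.2.2 h)
    simp

end Path

section

variable {X : Type*} [TopologicalSpace X] {y : X}

theorem loopClass_trans (γ δ : Path y y) :
    loopClass (γ.trans δ) = loopClass δ * loopClass γ := rfl

theorem loopClass_refl : loopClass (Path.refl y) = 1 := rfl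

theorem loopClass_mem_spanierGroupOfCover {𝒰 : Set (Set X)} {U : Set X} (hU : U ∈ 𝒰)
    {γ : Path y y} (hγ : range γ ⊆ U) : loopClass γ ∈ spanierGroupOfCover 𝒰 y := by
  refine Subgroup.subset_closure ⟨y, Path.refl y, γ, ⟨U, hU, hγ⟩, ?_⟩
  rw [Path.refl_symm, loopClass_trans, loopClass_trans, loopClass_refl, one_mul, mul_one]

/-- Near a wild point there are arbitrarily small loops outside a subgroup that contains all
sufficiently small loops. -/
theorem IsWildPoint.exists_loop (hy : IsWildPoint y) {W : Set X} (hW : IsOpen W) (hyW : y ∈ W) :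
    ∃ (γ : Path y y) (V : Set X) (H : Subgroup (FundamentalGroup X y)), range γ ⊆ W ∧ IsOpen V ∧
      y ∈ V ∧ loopClass γ ∉ H ∧ ∀ δ : Path y y, range δ ⊆ V → loopClass δ ∈ H := by
  obtain ⟨γ, hγW, hγ⟩ := hy.2 W hW hyW
  simp only [spanierGroup, Subgroup.mem_iInf, not_forall] at hγ
  obtain ⟨𝒰, h𝒰, hγ⟩ := hγ
  obtain ⟨V, hV, hyV⟩ : y ∈ ⋃₀ 𝒰 := h𝒰.2 ▸ mem_univ y
  exact ⟨γ, V, _, hγW, h𝒰.1 V hV, hyV, hγ, fun δ hδ => loopClass_mem_spanierGroupOfCover hV hδ⟩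

theorem IsWildPoint.exists_sequence [FirstCountableTopology X] (hy : IsWildPoint y) :
    ∃ (W : ℕ → Set X) (α : ℕ → Path y y) (H : ℕ → Subgroup (FundamentalGroup X y)),
      (𝓝 y).HasAntitoneBasis W ∧ (∀ n, range (α n) ⊆ W n) ∧ (∀ n, loopClass (α n) ∉ H n) ∧
      ∀ n, ∀ δ : Path y y, range δ ⊆ W (n + 1) → loopClass δ ∈ H n := by
  obtain ⟨B, hB, hbasis⟩ := (nhds_basis_opens y).exists_antitone_subbasis
  choose γ V H hγ hV hyV hγH hH using
    fun W : {W : Set X // IsOpen W ∧ y ∈ W} => hy.exists_loop W.2.1 W.2.2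
  -- Intersecting with `V W` puts later loops in the subgroup of stage `n`; intersecting with `B (n
  -- + 1)` keeps the sequence a basis.
  let N : ℕ → {W : Set X // IsOpen W ∧ y ∈ W} := fun n =>
    Nat.rec ⟨B 0, (hB 0).2, (hB 0).1⟩
      (fun n W => ⟨W ∩ V W ∩ B (n + 1), (W.2.1.inter (hV W)).inter (hB _).2,
        ⟨W.2.2, hyV W⟩, (hB _).1⟩) n
  have hsucc (n : ℕ) : (N (n + 1)).1 = (N n).1 ∩ V (N n) ∩ B (n + 1) := rfl
  have hNB (n : ℕ) : (N n).1 ⊆ B n := by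
    cases n with
    | zero => exact subset_rfl
    | succ n => exact inter_subset_right
  refine ⟨fun n => (N n).1, fun n => γ (N n), fun n => H (N n), ⟨⟨fun U => ⟨fun hU => ?_, ?_⟩⟩, ?_⟩,
    fun n => hγ _, fun n => hγH _, fun n δ hδ => hH _ δ (hδ.trans ?_)⟩
  · obtain ⟨n, -, hn⟩ := hbasis.1.mem_iff.1 hU
    exact ⟨n, trivial, (hNB n).trans hn⟩
  · rintro ⟨n, -, hn⟩
    exact mem_of_superset ((N n).2.1.mem_nhds (N n).2.2) hn
  · refine antitone_nat_of_succ_le fun n => ?_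
    rw [hsucc]
    exact inter_subset_left.trans inter_subset_left
  · simp only [hsucc]
    exact inter_subset_left.trans inter_subset_right

theorem IsWildPoint.uncountable_fundamentalGroup [FirstCountableTopology X] (hy : IsWildPoint y) :
    Uncountable (FundamentalGroup X y) := by
  obtain ⟨W, α, H, hW, hαW, hαH, hH⟩ := hy.exists_sequence
  -- The offset `n` makes `c s n` the class of the tail of the selection starting at `n`.
  let β (s : ℕ → Bool) (n k : ℕ) : Path y y := if s (n + k) then α (n + k) else Path.refl y
  have hyW (n : ℕ) : y ∈ W n := mem_of_mem_nhds (hW.1.mem_of_mem trivial)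
  have hβW (s : ℕ → Bool) (n k : ℕ) : range (β s n k) ⊆ W (n + k) := by
    by_cases h : s (n + k)
    · simpa only [β, if_pos h] using hαW (n + k)
    · simpa [β, if_neg h] using hyW (n + k)
  have hβ (s : ℕ → Bool) (n : ℕ) : Path.ShrinksToBase (β s n) := fun U hU => by
    obtain ⟨m, -, hm⟩ := hW.1.mem_iff.1 hU
    exact ⟨m, fun k hk => (hβW s n k).trans ((hW.2 (by omega)).trans hm)⟩
  let c (s : ℕ → Bool) (n : ℕ) : FundamentalGroup X y :=
    loopClass (Path.infiniteConcat (β s n) (hβ s n))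
  have htail (s : ℕ → Bool) (n : ℕ) : (fun k => β s n (k + 1)) = β s (n + 1) := by
    funext k
    simp only [β, add_assoc, add_comm 1 k]
  have hc (s : ℕ → Bool) (n : ℕ) : c s n = c s (n + 1) * loopClass (β s n 0) := by
    simp only [c]
    rw [Path.infiniteConcat_eq_trans, loopClass_trans]
    simp only [htail]
  have hcH (s : ℕ → Bool) (n : ℕ) : c s (n + 1) ∈ H n :=
    hH n _ (Path.range_infiniteConcat_subset (hyW _) _ fun k =>
      (hβW s (n + 1) k).trans (hW.2 (by omega)))
  have hct {s : ℕ → Bool} {n : ℕ} (h : s n = true) :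
      c s n = c s (n + 1) * loopClass (α n) := by simp [hc s n, β, h]
  have hcf {s : ℕ → Bool} {n : ℕ} (h : s n = false) : c s n = c s (n + 1) := by
    rw [hc s n]; simp [β, h, loopClass_refl]
  have hne {s t : ℕ → Bool} {n : ℕ} (hs : s n = true) (ht : t n = false) : c s n ≠ c t n := by
    intro h
    rw [hct hs, hcf ht] at h
    -- Both tails from `n + 1` lie in `H n`, so equality would force the class of `α n` into `H n`.
    exact hαH n ((Subgroup.mul_mem_cancel_left _ (hcH s n)).1 (h ▸ hcH t n))
  have hstep {s t : ℕ → Bool} {n : ℕ} (h : c s n = c t n) :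
      s n = t n ∧ c s (n + 1) = c t (n + 1) := by
    cases hs : s n <;> cases ht : t n
    · exact ⟨rfl, by rwa [hcf hs, hcf ht] at h⟩
    · exact absurd h.symm (hne ht hs)
    · exact absurd h (hne hs ht)
    · exact ⟨rfl, by rw [hct hs, hct ht] at h; exact mul_right_cancel h⟩
  have hinj : Function.Injective fun s => c s 0 := by
    intro s t h
    have hall (n : ℕ) : c s n = c t n := by
      induction n with
      | zero => exact h
      | succ n ih => exact (hstep ih).2
    exact funext fun n => (hstep (hall n)).1
  have : Uncountable (ℕ → Bool) := by
    rw [← Cardinal.aleph0_lt_mk_iff]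
    simpa using Cardinal.cantor Cardinal.aleph0
  exact hinj.uncountable

end

theorem mainTheorem7 {X : Type*} [TopologicalSpace X] [ConnectedSpace X] [LocallyPathConnectedSpace X]
    [FirstCountableTopology X] (hwild : ∃ y : X, IsWildPoint y) (x : X) :
    Uncountable (FundamentalGroup X x) := by
  obtain ⟨y, hy⟩ := hwild
  have := hy.uncountable_fundamentalGroup
  have : PathConnectedSpace X := pathConnectedSpace_iff_connectedSpace.2 inferInstance
  -- A change of base point moves the result from `y` to `x`.
  exact (FundamentalGroup.fundamentalGroupMulEquivOfPathConnected y x).injective.uncountable
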